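/- Let $\mathcal P$ be a finite set of atomic propositions and $\Sigma=2^{\mathcal P}$. Discounted LTL formulas over $\mathcal P$ are given by $$\varphi ::= b\in\mathcal P \mid \lnot\varphi\mid \varphi\lor\varphi\mid \mathbf X_\lambda\varphi\mid\varphi\,\mathbf U_\lambda\varphi,\qquad \lambda\in[0,1),$$ where different temporal operators may carry different discount factors. The value $[\![\varphi,\rho]\!]\in[0,1]$ of $\varphi$ on $\rho=\sigma_0\sigma_1\ldots\in\Sigma^\omega$, with $\rho_{i:\infty}=\sigma_i\sigma_{i+1}\ldots$, is defined by $[\![b,\rho]\!]=1$ if $b\in\sigma_0$ and $0$ otherwise; $[\![\lnot\varphi,\rho]\!]=1-[\![\varphi,\rho]\!]$; $[\![\varphi_1\lor\varphi_2,\rho]\!]=\max\{[\![\varphi_1,\rho]\!],[\![\varphi_2,\rho]\!]\}$; $[\![\mathbf X_\lambda\varphi,\rho]\!]=\lambda\,[\![\varphi,\rho_{1:\infty}]\!]$; and $$[\![\varphi_1\mathbf U_\lambda\varphi_2,\rho]\!]=\sup_{i\ge0}\ \min\Big(\{\lambda^i[\![\varphi_2,\rho_{i:\infty}]\!]\}\cup\{\lambda^j[\![\varphi_1,\rho_{j:\infty}]\!]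 : 0\le j<i\}\Big).$$ A reward machine is a tuple $\mathcal R=(Q,\delta,r,q_0,\lambda)$ with a finite set $Q$ of states, a transition function $\delta:Q\times\Sigma\to Q$, a reward function $r:Q\times\Sigma\to\mathbb R$, an initial state $q_0\in Q$ and a discount factor $\lambda\in[0,1)$. Its discounted-sum reward on $\rho=\sigma_0\sigma_1\ldots$ is $\mathcal R(\rho)=\sum_{t=0}^\infty\lambda^t r(q_t,\sigma_t)$, where $q_{t+1}=\delta(q_t,\sigma_t)$ for $t\ge0$. Theorem. Let $\lambda\in[0,1)$ and let $\varphi$ be a discounted LTL formula all of whose temporal operators carry the discount factor $\lambda$. Then there is a reward machine $\mathcal R_\varphi=(Q,\delta,r,q_0,\lambda)$ such that 1. $\mathcal R_\varphi(\rho)=[\![\varphi,\rho]\!]$ for every $\rho\in\Sigma^\omega$; 2. there are a partition $Q=\bigcup_{\ell=1}^{L}Q_\ell$ into nonempty blocks and a map $\chi:\{1,\dots,L\}\to\{0,1-\lambda\}$ such that for all $\ell$, all $q\in Q_\ell$ and all $\sigma\in\Sigma$: $\delta(q,\sigma)\in\bigcup_{m=\ell}^{L}Q_m$, and if $\delta(q,\sigma)\in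 Q_\ell$ then $r(q,\sigma)=\chi(\ell)$ (so all transitions inside a strongly connected component of $\mathcal R_\varphi$ have one and the same reward, which is $0$ or $1-\lambda$); 3. $0\le r(q,\sigma)\le 1-\lambda$ for all $q\in Q$ and $\sigma\in\Sigma$. -/

import Mathlib

/-- Formulas of discounted LTL over the atomic propositions `P`. Each temporal operator
carries its own discount factor in `[0,1)`. -/
inductive DLTL (P : Type*) : Type _ where
  | atom (b : P) : DLTL P
  | neg (φ : DLTL P) : DLTL P
  | or (φ₁ φ₂ : DLTL P) : DLTL P
  | next (d : Set.Ico (0 : ℝ) 1) (φ : DLTL P) : DLTL P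
  | untl (d : Set.Ico (0 : ℝ) 1) (φ₁ φ₂ : DLTL P) : DLTL P

namespace DLTL

/-- Infinite words over the alphabet `2^P`. -/
abbrev Word (P : Type*) := ℕ → Set P

/-- The infinite word `ρ_i ρ_{i+1} …`. -/
def suffix {P : Type*} (ρ : Word P) (i : ℕ) : Word P := fun n => ρ (i + n)

open scoped Classical in
/-- The value of a formula on an infinite word. In the until case,
`(Finset.range i).fold min a f` is `min {a, f 0, …, f (i-1)}`. -/
noncomputable def sem {P : Type*} : DLTL P → Word P → ℝ
  | atom b, ρ => if b ∈ ρ 0 then 1 else 0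
  | neg φ, ρ => 1 - sem φ ρ
  | or φ₁ φ₂, ρ => max (sem φ₁ ρ) (sem φ₂ ρ)
  | next d φ, ρ => (d : ℝ) * sem φ (suffix ρ 1)
  | untl d φ₁ φ₂, ρ =>
      ⨆ i : ℕ, (Finset.range i).fold min ((d : ℝ) ^ i * sem φ₂ (suffix ρ i))
        (fun j => (d : ℝ) ^ j * sem φ₁ (suffix ρ j))

/-- All temporal operators of the formula carry the same discount factor `d`. -/
def IsUniform {P : Type*} (d : Set.Ico (0 : ℝ) 1) : DLTL P → Prop
  | atom _ => True
  | neg φ => IsUniform d φ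
  | or φ₁ φ₂ => IsUniform d φ₁ ∧ IsUniform d φ₂
  | next e φ => e = d ∧ IsUniform d φ
  | untl e φ₁ φ₂ => e = d ∧ IsUniform d φ₁ ∧ IsUniform d φ₂

/-- Every formula has a value in `[0,1]`; in particular the supremum in the until case is one of
a bounded set. -/
theorem sem_mem_Icc {P : Type*} (φ : DLTL P) (ρ : Word P) :
    sem φ ρ ∈ Set.Icc (0 : ℝ) 1 := by
  have key : ∀ (d : Set.Ico (0 : ℝ) 1) (n : ℕ) (x : ℝ), x ∈ Set.Icc (0 : ℝ) 1 →
      (d : ℝ) ^ n * x ∈ Set.Icc (0 : ℝ) 1 := fun d n x hx =>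
    ⟨mul_nonneg (pow_nonneg d.2.1 n) hx.1,
      mul_le_one₀ (pow_le_one₀ d.2.1 d.2.2.le) hx.1 hx.2⟩
  induction φ generalizing ρ with
  | atom b => by_cases h : b ∈ ρ 0 <;> simp [sem, h]
  | neg φ ih => obtain ⟨h₀, h₁⟩ := ih ρ; simp only [sem, Set.mem_Icc]; constructor <;> linarith
  | or φ₁ φ₂ ih₁ ih₂ =>
    exact ⟨le_max_of_le_left (ih₁ ρ).1, max_le (ih₁ ρ).2 (ih₂ ρ).2⟩
  | next d φ ih => simpa [sem] using key d 1 _ (ih (suffix ρ 1))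
  | untl d φ₁ φ₂ ih₁ ih₂ =>
    refine ⟨Real.iSup_nonneg fun i => ?_, ciSup_le fun i => ?_⟩
    · exact (Finset.le_fold_min _).2 ⟨(key d i _ (ih₂ _)).1, fun j _ => (key d j _ (ih₁ _)).1⟩
    · exact (Finset.fold_min_le _).2 (Or.inl (key d i _ (ih₂ _)).2)

end DLTL

/-- A reward machine over the alphabet `A`: a finite deterministic machine with a reward on every
transition and a discount factor in `[0,1)`. -/
structure RewardMachine (A : Type*) where
  Q : Type
  finite_Q : Finite Q
  δ : Q → A → Q
  r : Q → A → ℝ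
  q₀ : Q
  discount : Set.Ico (0 : ℝ) 1

namespace RewardMachine

/-- The state of the machine before it reads letter number `t` of the infinite word `ρ`. -/
def run {A : Type*} (R : RewardMachine A) (ρ : ℕ → A) : ℕ → R.Q
  | 0 => R.q₀
  | t + 1 => R.δ (run R ρ t) (ρ t)

/-- The discounted-sum reward of an infinite word. -/
noncomputable def value {A : Type*} (R : RewardMachine A) (ρ : ℕ → A) : ℝ :=
  ∑' t : ℕ, (R.discount : ℝ) ^ t * R.r (R.run ρ t) (ρ t)

/-- Over a finite alphabet, the series that defines the discounted-sum reward converges. -/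
theorem summable_value {A : Type*} [Finite A] (R : RewardMachine A) (ρ : ℕ → A) :
    Summable fun t : ℕ => (R.discount : ℝ) ^ t * R.r (R.run ρ t) (ρ t) := by
  have := R.finite_Q
  obtain ⟨M, hM⟩ := (Set.finite_range fun p : R.Q × A => |R.r p.1 p.2|).bddAbove
  refine Summable.of_norm_bounded
    ((summable_geometric_of_lt_one R.discount.2.1 R.discount.2.2).mul_right M) fun t => ?_
  rw [norm_mul, norm_pow, Real.norm_eq_abs, Real.norm_eq_abs, abs_of_nonneg R.discount.2.1]
  exact mul_le_mul_of_nonneg_left (hM ⟨(R.run ρ t, ρ t), rfl⟩) (pow_nonneg R.discount.2.1 t)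

/-- The states can be partitioned into an ordered list of nonempty blocks `Q_0, …, Q_{L-1}`
(`block q` is the index of the block of `q`), with types `χ ℓ` in `{0, 1 - discount}`, such that no
transition leads to an earlier block and every transition that stays in a block has the type of
that block as its reward. -/
def HasTypedPartition {A : Type*} (R : RewardMachine A) : Prop :=
  ∃ (L : ℕ) (block : R.Q → Fin L) (χ : Fin L → ℝ),
    Function.Surjective block ∧
    (∀ ℓ, χ ℓ = 0 ∨ χ ℓ = 1 - (R.discount : ℝ)) ∧
    ∀ (q : R.Q) (σ : A),
      block q ≤ block (R.δ q σ) ∧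
      (block (R.δ q σ) = block q → R.r q σ = χ (block q))

end RewardMachine

/-!
The letters of a finite prefix `w` determine a guaranteed value `finVal φ w`, obtained by evaluating
`φ` recursively along `w` with everything unknown about the future set to its least value. After `n`
letters the guaranteed value is within `lam ^ n` of the true one (`DLTL.finVal_le_sem`, from the
expansion law of the until operator). So the word is evaluated by the machine that pays, for each
letter, the increase of the guaranteed value. Its natural states are the residuals
`v ↦ (finVal φ (w ++ v) - finVal φ w) / lam ^ |w|`; the rewards lie in `[0, 1 - lam]` automatically.
It remains to show that there are finitely many residuals, and that a cycle of residuals pays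
constantly `0` or constantly `1 - lam`; the blocks are then the strongly connected components in a
linear order that extends reachability (`exists_rewardMachine`).

Both facts use the structure of `finVal φ`: it belongs to a `WeakSystem`, a finite family of
functions each of which is, after removal of the first letter, a lattice polynomial in functions
`c + lam * fn j` with `c` equal to `0` or `1 - lam`, such that apart from loops of constant weight
all dependences lower a rank (`DLTL.exists_weakSystem`). Unrolling along `w`, `fn i (w ++ v)` is a
lattice polynomial in the functions `weight + lam ^ |w| * fn j v`, one for each path of length
`|w|`, and `fn i w` is the weight of one of the paths.

* Finiteness (`WeakSystem.finite_range_prefixResidual`): a residual is a lattice polynomial in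
  truncations of the functions `x + fn j`, with `x` the gap, in units of `lam ^ |w|`, between the
  weights of two paths. Only gaps in `(-1, 1)` matter. A gap evolves by `x ↦ (x + e) / lam`; this
  map is expanding, the step `e` changes boundedly often because of the ranks, and each phase with
  constant `e` leaves `(-1, 1)` or rests at a fixed point, so there are finitely many such gaps
  (`WeakSystem.finite_gaps`). A finitely generated distributive lattice is finite.
* Cycles (`WeakSystem.prefixResidual_cycle`): go around a cycle many times and take a path whose
  weight is the guaranteed value at the end. By the pigeonhole principle it is at the same index
  with the same gap at two passages, hence has looped in between, and its gap there is `V` or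
  `V - 1`, for `V` the discounted sum of the rewards along the cycle repeated for ever. In the first
  case the gap is at least `V` and in the second at most `V - 1` at every later passage. As the gap
  is `0` at the end, `V` is `0` or `1`, which forces all rewards to be extremal.

The division by `lam` requires a separate machine for discount factor `0`.
-/

/-! ### Values of finite words -/

/-- The prefix of length `n` of an infinite word. -/
def wordPrefix {A : Type*} (ρ : ℕ → A) (n : ℕ) : List A := List.ofFn fun i : Fin n => ρ i

@[simp] theorem wordPrefix_zero {A : Type*} (ρ : ℕ → A) : wordPrefix ρ 0 = [] := by
  simp [wordPrefix]

@[simp] theorem length_wordPrefix {A : Type*} (ρ : ℕ → A) (n : ℕ) :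
    (wordPrefix ρ n).length = n := by
  simp [wordPrefix]

theorem wordPrefix_succ {A : Type*} (ρ : ℕ → A) (n : ℕ) :
    wordPrefix ρ (n + 1) = ρ 0 :: wordPrefix (fun m => ρ (1 + m)) n := by
  simp [wordPrefix, List.ofFn_succ, add_comm]

theorem wordPrefix_succ' {A : Type*} (ρ : ℕ → A) (n : ℕ) :
    wordPrefix ρ (n + 1) = wordPrefix ρ n ++ [ρ n] := by
  rw [wordPrefix, List.ofFn_succ_last]
  rfl

namespace DLTL

variable {P : Type*}

/-- The shift `v ↦ lam * f (tail of v)` on functions of finite words, with value `0` on the empty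
word. -/
def nextFn {A : Type*} (lam : ℝ) (f : List A → ℝ) : List A → ℝ
  | [] => 0
  | _ :: v => lam * f v

/-- The unfolding of the until operator along a finite word, with value `0` on the empty word. -/
def untlFn {A : Type*} (lam : ℝ) (f g : List A → ℝ) : List A → ℝ
  | [] => 0
  | a :: v => max (g (a :: v)) (min (f (a :: v)) (lam * untlFn lam f g v))

open scoped Classical in
/-- The value of an atomic proposition on a finite word: the discounted sum of the constant reward
`1 - lam` or `0`, depending on the first letter. -/
noncomputable def atomFn (lam : ℝ) (b : P) : List (Set P) → ℝ
  | [] => 0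
  | a :: v => if b ∈ a then 1 - lam ^ (v.length + 1) else 0

/-- A recursively computed lower bound for the values of a formula on the infinite extensions of a
finite word `v`. The matching upper bound is greater by `lam ^ |v|`, hence the case of the negation.
The discount factors written in the formula are ignored in favour of `lam`. -/
noncomputable def finVal (lam : ℝ) : DLTL P → List (Set P) → ℝ
  | atom b => atomFn lam b
  | neg φ => fun v => 1 - lam ^ v.length - finVal lam φ v
  | or φ ψ => finVal lam φ ⊔ finVal lam ψ
  | next _ φ => nextFn lam (finVal lam φ)
  | untl _ φ ψ => untlFn lam (finVal lam φ) (finVal lam ψ)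

theorem finVal_nil (lam : ℝ) (φ : DLTL P) : finVal lam φ [] = 0 := by
  induction φ with
  | atom b => rfl
  | neg φ ih => simp [finVal, ih]
  | or φ ψ ih₁ ih₂ => simp [finVal, ih₁, ih₂]
  | next d φ ih => rfl
  | untl d φ ψ ih₁ ih₂ => rfl

theorem suffix_zero (ρ : Word P) : suffix ρ 0 = ρ := by
  funext n; simp [suffix]

theorem suffix_suffix (ρ : Word P) (i j : ℕ) : suffix (suffix ρ i) j = suffix ρ (i + j) := by
  funext n; simp [suffix, add_assoc]

/-- The term of index `i` in the supremum that defines `φ U ψ`. -/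
noncomputable def untlTerm (d : Set.Ico (0 : ℝ) 1) (φ ψ : DLTL P) (ρ : Word P) (i : ℕ) : ℝ :=
  (Finset.range i).fold min ((d : ℝ) ^ i * sem ψ (suffix ρ i))
    (fun j => (d : ℝ) ^ j * sem φ (suffix ρ j))

theorem le_untlTerm_iff {d : Set.Ico (0 : ℝ) 1} {φ ψ : DLTL P} {ρ : Word P} {i : ℕ} {x : ℝ} :
    x ≤ untlTerm d φ ψ ρ i ↔ x ≤ (d : ℝ) ^ i * sem ψ (suffix ρ i) ∧
      ∀ j < i, x ≤ (d : ℝ) ^ j * sem φ (suffix ρ j) := by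
  simp [untlTerm, Finset.le_fold_min]

theorem untlTerm_zero (d : Set.Ico (0 : ℝ) 1) (φ ψ : DLTL P) (ρ : Word P) :
    untlTerm d φ ψ ρ 0 = sem ψ ρ := by
  simp [untlTerm, suffix_zero]

theorem untlTerm_le_one (d : Set.Ico (0 : ℝ) 1) (φ ψ : DLTL P) (ρ : Word P) (i : ℕ) :
    untlTerm d φ ψ ρ i ≤ 1 :=
  (le_untlTerm_iff.1 le_rfl).1.trans
    (mul_le_one₀ (pow_le_one₀ d.2.1 d.2.2.le) (sem_mem_Icc _ _).1 (sem_mem_Icc _ _).2)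

theorem bddAbove_untlTerm (d : Set.Ico (0 : ℝ) 1) (φ ψ : DLTL P) (ρ : Word P) :
    BddAbove (Set.range (untlTerm d φ ψ ρ)) :=
  ⟨1, by rintro _ ⟨i, rfl⟩; exact untlTerm_le_one d φ ψ ρ i⟩

theorem untlTerm_succ (d : Set.Ico (0 : ℝ) 1) (φ ψ : DLTL P) (ρ : Word P) (i : ℕ) :
    untlTerm d φ ψ ρ (i + 1) = min (sem φ ρ) (d * untlTerm d φ ψ (suffix ρ 1) i) := by
  have hmono : Monotone fun x : ℝ => (d : ℝ) * x := monotone_mul_left_of_nonneg d.2.1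
  -- multiplication by `d ≥ 0` commutes with the minimum
  have hmul : (d : ℝ) * untlTerm d φ ψ (suffix ρ 1) i =
      (Finset.range i).fold min ((d : ℝ) ^ (i + 1) * sem ψ (suffix ρ (i + 1)))
        (fun j => (d : ℝ) ^ (j + 1) * sem φ (suffix ρ (j + 1))) := by
    have h := Finset.fold_hom (op := min) (op' := min) (s := Finset.range i)
      (f := fun j => (d : ℝ) ^ j * sem φ (suffix (suffix ρ 1) j))
      (b := (d : ℝ) ^ i * sem ψ (suffix (suffix ρ 1) i)) (m := fun x : ℝ => (d : ℝ) * x)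
      (fun x y => hmono.map_min)
    rw [untlTerm, ← h]
    simp only [suffix_suffix, ← mul_assoc, ← pow_succ', add_comm 1]
  refine eq_of_forall_le_iff fun x => ?_
  rw [hmul, le_untlTerm_iff, le_min_iff, Finset.le_fold_min]
  constructor
  · rintro ⟨h₁, h₂⟩
    refine ⟨by simpa [suffix_zero] using h₂ 0 (by omega), h₁, fun j hj => h₂ (j + 1) ?_⟩
    have := Finset.mem_range.1 hj
    omega
  · rintro ⟨h₀, h₁, h₂⟩
    refine ⟨h₁, fun j hj => ?_⟩
    cases j with
    | zero => simpa [suffix_zero] using h₀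
    | succ j => exact h₂ j (Finset.mem_range.2 (by omega))

/-- The expansion law of the until operator. -/
theorem sem_untl_expand (d : Set.Ico (0 : ℝ) 1) (φ ψ : DLTL P) (ρ : Word P) :
    sem (untl d φ ψ) ρ = max (sem ψ ρ) (min (sem φ ρ) (d * sem (untl d φ ψ) (suffix ρ 1))) := by
  have hsem : ∀ ρ : Word P, sem (untl d φ ψ) ρ = ⨆ i, untlTerm d φ ψ ρ i := fun ρ => rfl
  have hmin : min (sem φ ρ) (d * sem (untl d φ ψ) (suffix ρ 1)) =
      ⨆ i, untlTerm d φ ψ ρ (i + 1) := by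
    simp_rw [untlTerm_succ, hsem]
    refine Monotone.map_ciSup_of_continuousAt (f := fun x : ℝ => min (sem φ ρ) (d * x))
      (Continuous.continuousAt (by fun_prop))
      (fun x y hxy => min_le_min le_rfl (mul_le_mul_of_nonneg_left hxy d.2.1))
      (bddAbove_untlTerm d φ ψ _)
  have hbdd : BddAbove (Set.range fun i => untlTerm d φ ψ ρ (i + 1)) :=
    ⟨1, by rintro _ ⟨i, rfl⟩; exact untlTerm_le_one d φ ψ ρ _⟩
  rw [hmin, hsem, ← untlTerm_zero d φ ψ ρ]
  apply le_antisymm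
  · refine ciSup_le fun i => ?_
    cases i with
    | zero => exact le_max_left _ _
    | succ i => exact (le_ciSup hbdd i).trans (le_max_right _ _)
  · exact max_le (le_ciSup (bddAbove_untlTerm d φ ψ ρ) 0)
      (ciSup_le fun i => le_ciSup (bddAbove_untlTerm d φ ψ ρ) (i + 1))

/-- After `n` letters, the value of a formula is known up to `d ^ n`. -/
theorem finVal_le_sem {d : Set.Ico (0 : ℝ) 1} {φ : DLTL P} (hφ : φ.IsUniform d) (ρ : Word P)
    (n : ℕ) :
    finVal d φ (wordPrefix ρ n) ≤ sem φ ρ ∧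
      sem φ ρ ≤ finVal d φ (wordPrefix ρ n) + (d : ℝ) ^ n := by
  have hd₀ := d.2.1
  have hd₁ := d.2.2.le
  have hzero : ∀ (φ : DLTL P) (ρ : Word P), finVal d φ (wordPrefix ρ 0) ≤ sem φ ρ ∧
      sem φ ρ ≤ finVal d φ (wordPrefix ρ 0) + (d : ℝ) ^ 0 := fun φ ρ => by
    simpa [finVal_nil] using sem_mem_Icc φ ρ
  induction φ generalizing ρ n with
  | atom b =>
    cases n with
    | zero => exact hzero _ ρ
    | succ n =>
      have := pow_nonneg hd₀ (n + 1)
      by_cases h : b ∈ ρ 0 <;> simp [finVal, atomFn, sem, wordPrefix_succ, h, this]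
  | neg φ ih =>
    have := ih hφ ρ n
    simp only [finVal, sem, length_wordPrefix]
    exact ⟨by linarith [this.2], by linarith [this.1]⟩
  | or φ ψ ih₁ ih₂ =>
    have h₁ := ih₁ hφ.1 ρ n
    have h₂ := ih₂ hφ.2 ρ n
    simp only [finVal, sem, Pi.sup_apply]
    rw [← max_add_add_right]
    exact ⟨max_le_max h₁.1 h₂.1, max_le_max h₁.2 h₂.2⟩
  | next e φ ih =>
    cases n with
    | zero => exact hzero _ ρ
    | succ n =>
      obtain ⟨rfl, hφ⟩ := hφ
      obtain ⟨h₁, h₂⟩ := ih hφ (suffix ρ 1) n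
      simp only [finVal, sem, wordPrefix_succ, nextFn]
      exact ⟨mul_le_mul_of_nonneg_left h₁ hd₀, (mul_le_mul_of_nonneg_left h₂ hd₀).trans_eq
        (by rw [mul_add, pow_succ']; rfl)⟩
  | untl e φ ψ ih₁ ih₂ =>
    induction n generalizing ρ with
    | zero => exact hzero _ ρ
    | succ n ih =>
      obtain ⟨h₁, h₂⟩ := ih (suffix ρ 1)
      obtain ⟨h₃, h₄⟩ := ih₁ hφ.2.1 ρ (n + 1)
      obtain ⟨h₅, h₆⟩ := ih₂ hφ.2.2 ρ (n + 1)
      obtain rfl := hφ.1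
      have hexp : finVal e (untl e φ ψ) (wordPrefix ρ (n + 1)) =
          max (finVal e ψ (wordPrefix ρ (n + 1))) (min (finVal e φ (wordPrefix ρ (n + 1)))
            (e * finVal e (untl e φ ψ) (wordPrefix (suffix ρ 1) n))) := by
        simp only [finVal, wordPrefix_succ, untlFn]
        rfl
      rw [sem_untl_expand, hexp, ← max_add_add_right, ← min_add_add_right]
      refine ⟨max_le_max h₅ (min_le_min h₃ (mul_le_mul_of_nonneg_left h₁ hd₀)),
        max_le_max h₆ (min_le_min h₄ ((mul_le_mul_of_nonneg_left h₂ hd₀).trans_eq ?_))⟩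
      rw [mul_add, pow_succ']

end DLTL

/-! ### Weak systems of functions on finite words -/

theorem map_mem_latticeClosure {α β : Type*} [Lattice α] [Lattice β] {Φ : α → β}
    (hsup : ∀ a b, Φ (a ⊔ b) = Φ a ⊔ Φ b) (hinf : ∀ a b, Φ (a ⊓ b) = Φ a ⊓ Φ b)
    {s : Set α} {t : Set β} (h : ∀ a ∈ s, Φ a ∈ latticeClosure t) {a : α}
    (ha : a ∈ latticeClosure s) : Φ a ∈ latticeClosure t :=
  latticeClosure_min (t := {a | Φ a ∈ latticeClosure t}) h
    ⟨fun a ha b hb => by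
        simpa only [Set.mem_ofPred_eq, hsup] using isSublattice_latticeClosure.supClosed ha hb,
      fun a ha b hb => by
        simpa only [Set.mem_ofPred_eq, hinf] using isSublattice_latticeClosure.infClosed ha hb⟩ ha

theorem map_mem_latticeClosure_of_anti {α β : Type*} [Lattice α] [Lattice β] {Φ : α → β}
    (hsup : ∀ a b, Φ (a ⊔ b) = Φ a ⊓ Φ b) (hinf : ∀ a b, Φ (a ⊓ b) = Φ a ⊔ Φ b)
    {s : Set α} {t : Set β} (h : ∀ a ∈ s, Φ a ∈ latticeClosure t) {a : α}
    (ha : a ∈ latticeClosure s) : Φ a ∈ latticeClosure t :=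
  latticeClosure_min (t := {a | Φ a ∈ latticeClosure t}) h
    ⟨fun a ha b hb => by
        simpa only [Set.mem_ofPred_eq, hsup] using isSublattice_latticeClosure.infClosed ha hb,
      fun a ha b hb => by
        simpa only [Set.mem_ofPred_eq, hinf] using isSublattice_latticeClosure.supClosed ha hb⟩ ha

/-- A step from index `i` to index `j` with weight `c`: either a loop, whose weight is determined
by `i`, or a step to lower rank with weight `0` or `1 - lam`. -/
def WeakStep {ι : Type} (lam : ℝ) (rk : ι → ℕ) (loop : ι → ℝ) (i : ι) (c : ℝ) (j : ι) : Prop :=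
  (j = i ∧ c = loop i) ∨ (rk j < rk i ∧ (c = 0 ∨ c = 1 - lam))

/-- A finite family of functions on finite words, each of which is determined by the values of the
family on the tail of the word: after removal of the first letter, `fn i` is a lattice polynomial
in functions `c + lam * fn j`, where `i → j` is a step of weight `c`. This is a very weak weighted
alternating automaton: the only cycles among its indices are loops, each with a fixed weight. -/
structure WeakSystem (A : Type*) (lam : ℝ) where
  ι : Type
  finite_ι : Finite ι
  fn : ι → List A → ℝ
  rk : ι → ℕ
  loop : ι → ℝ
  loop_mem : ∀ i, loop i = 0 ∨ loop i = 1 - lam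
  fn_nil : ∀ i, fn i [] = 0
  fn_cons : ∀ i a, (fun v => fn i (a :: v)) ∈
    latticeClosure {g | ∃ c j, WeakStep lam rk loop i c j ∧ g = fun v => c + lam * fn j v}

namespace WeakSystem

variable {A : Type*} {lam : ℝ}

/-- The functions `c + lam * fn j` with `c` equal to `0` or `1 - lam`. -/
def gen (S : WeakSystem A lam) : Set (List A → ℝ) :=
  {g | ∃ c j, (c = 0 ∨ c = 1 - lam) ∧ g = fun v => c + lam * S.fn j v}

theorem step_weight (S : WeakSystem A lam) {i j : S.ι} {c : ℝ}
    (h : WeakStep lam S.rk S.loop i c j) : c = 0 ∨ c = 1 - lam := by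
  rcases h with ⟨-, rfl⟩ | ⟨-, h⟩
  exacts [S.loop_mem i, h]

theorem fn_cons_mem_gen (S : WeakSystem A lam) (i : S.ι) (a : A) :
    (fun v => S.fn i (a :: v)) ∈ latticeClosure S.gen :=
  latticeClosure_mono (by
    rintro g ⟨c, j, h, rfl⟩
    exact ⟨c, j, S.step_weight h, rfl⟩) (S.fn_cons i a)

/-- The constant rewards `0` and `1 - lam` form a weak system. -/
def constants (A : Type*) (lam : ℝ) : WeakSystem A lam where
  ι := Bool
  finite_ι := inferInstance
  fn b v := if b then 1 - lam ^ v.length else 0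
  rk _ := 0
  loop b := if b then 1 - lam else 0
  loop_mem b := by cases b <;> simp
  fn_nil b := by cases b <;> simp
  fn_cons b a := subset_latticeClosure ⟨_, b, Or.inl ⟨rfl, rfl⟩, by
    funext v
    cases b
    · simp
    · simp only [List.length_cons, if_true]
      ring⟩

/-- The complementary system, which contains `1 - lam ^ |v| - f v` for each member `f`. -/
def neg (S : WeakSystem A lam) : WeakSystem A lam where
  ι := S.ι
  finite_ι := S.finite_ι
  fn i v := 1 - lam ^ v.length - S.fn i v
  rk := S.rk
  loop i := 1 - lam - S.loop i
  loop_mem i := by rcases S.loop_mem i with h | h <;> simp [h]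
  fn_nil i := by simp [S.fn_nil]
  fn_cons i a := by
    refine map_mem_latticeClosure_of_anti
      (Φ := fun (g : List A → ℝ) (v : List A) => 1 - lam ^ (v.length + 1) - g v)
      (fun g h => ?_) (fun g h => ?_) ?_ (S.fn_cons i a)
    · funext v
      simp only [Pi.sup_apply, Pi.inf_apply]
      exact (Antitone.map_max fun x y hxy => sub_le_sub_left hxy _)
    · funext v
      simp only [Pi.sup_apply, Pi.inf_apply]
      exact (Antitone.map_min fun x y hxy => sub_le_sub_left hxy _)
    · rintro g ⟨c, j, h, rfl⟩
      refine subset_latticeClosure ⟨1 - lam - c, j, ?_, ?_⟩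
      · rcases h with ⟨rfl, rfl⟩ | ⟨h, rfl | rfl⟩
        · exact Or.inl ⟨rfl, rfl⟩
        · exact Or.inr ⟨h, Or.inr (by ring)⟩
        · exact Or.inr ⟨h, Or.inl (by ring)⟩
      · funext v
        ring

/-- The union of two systems. -/
def sum (S T : WeakSystem A lam) : WeakSystem A lam where
  ι := S.ι ⊕ T.ι
  finite_ι := by
    have := S.finite_ι
    have := T.finite_ι
    infer_instance
  fn := Sum.elim S.fn T.fn
  rk := Sum.elim S.rk T.rk
  loop := Sum.elim S.loop T.loop
  loop_mem := by rintro (i | i); exacts [S.loop_mem i, T.loop_mem i]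
  fn_nil := by rintro (i | i); exacts [S.fn_nil i, T.fn_nil i]
  fn_cons := by
    rintro (i | i) a
    · refine latticeClosure_mono ?_ (S.fn_cons i a)
      rintro g ⟨c, j, h, rfl⟩
      exact ⟨c, Sum.inl j, h.imp_left fun h => ⟨congrArg Sum.inl h.1, h.2⟩, rfl⟩
    · refine latticeClosure_mono ?_ (T.fn_cons i a)
      rintro g ⟨c, j, h, rfl⟩
      exact ⟨c, Sum.inr j, h.imp_left fun h => ⟨congrArg Sum.inr h.1, h.2⟩, rfl⟩

theorem exists_rk_lt (S : WeakSystem A lam) : ∃ M, ∀ i, S.rk i < M := by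
  have := S.finite_ι
  obtain ⟨M, hM⟩ := (Set.finite_range S.rk).bddAbove
  exact ⟨M + 1, fun i => Nat.lt_succ_of_le (hM ⟨i, rfl⟩)⟩

/-- A system extended by a new function, of highest rank, that may depend on itself through a loop
of weight `c`. -/
noncomputable def adjoin (S : WeakSystem A lam) (f : List A → ℝ) (c : ℝ)
    (hc : c = 0 ∨ c = 1 - lam) (hnil : f [] = 0)
    (hcons : ∀ a, (fun v => f (a :: v)) ∈
      latticeClosure (insert (fun v => c + lam * f v) S.gen)) : WeakSystem A lam where
  ι := Option S.ι
  finite_ι := by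
    have := S.finite_ι
    infer_instance
  fn i := i.elim f S.fn
  rk i := i.elim S.exists_rk_lt.choose S.rk
  loop i := i.elim c S.loop
  loop_mem := by rintro (_ | i); exacts [hc, S.loop_mem i]
  fn_nil := by rintro (_ | i); exacts [hnil, S.fn_nil i]
  fn_cons := by
    rintro (_ | i) a
    · refine latticeClosure_mono ?_ (hcons a)
      rintro g (rfl | ⟨c', j, hc', rfl⟩)
      · exact ⟨c, none, Or.inl ⟨rfl, rfl⟩, rfl⟩
      · exact ⟨c', some j, Or.inr ⟨S.exists_rk_lt.choose_spec j, hc'⟩, rfl⟩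
    · refine latticeClosure_mono ?_ (S.fn_cons i a)
      rintro g ⟨c, j, h, rfl⟩
      exact ⟨c, some j, h.imp_left fun h => ⟨congrArg some h.1, h.2⟩, rfl⟩

end WeakSystem

/-- Every formula belongs to a weak system. -/
theorem DLTL.exists_weakSystem {P : Type*} (lam : ℝ) (φ : DLTL P) :
    ∃ (S : WeakSystem (Set P) lam) (i : S.ι), S.fn i = finVal lam φ := by
  induction φ with
  | atom b =>
    refine ⟨(WeakSystem.constants _ lam).adjoin (finVal lam (atom b)) 0 (Or.inl rfl) rfl
      fun a => latticeClosure_mono (Set.subset_insert _ _) (subset_latticeClosure ?_), none, rfl⟩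
    by_cases h : b ∈ a
    · refine ⟨1 - lam, true, Or.inr rfl, funext fun v => ?_⟩
      simp only [finVal, atomFn, h, WeakSystem.constants, if_true]
      ring
    · refine ⟨0, false, Or.inl rfl, funext fun v => ?_⟩
      simp [finVal, atomFn, h, WeakSystem.constants]
  | neg φ ih =>
    obtain ⟨S, i, hi⟩ := ih
    exact ⟨S.neg, i, by simp only [WeakSystem.neg, hi, finVal]⟩
  | or φ ψ ih₁ ih₂ =>
    obtain ⟨S, i, hi⟩ := ih₁
    obtain ⟨T, j, hj⟩ := ih₂
    refine ⟨(S.sum T).adjoin (finVal lam (or φ ψ)) 0 (Or.inl rfl) (finVal_nil lam _)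
      fun a => latticeClosure_mono (Set.subset_insert _ _) ?_, none, rfl⟩
    have h₁ := (S.sum T).fn_cons_mem_gen (Sum.inl i) a
    have h₂ := (S.sum T).fn_cons_mem_gen (Sum.inr j) a
    simp only [WeakSystem.sum, Sum.elim_inl, Sum.elim_inr, hi, hj] at h₁ h₂
    exact isSublattice_latticeClosure.supClosed h₁ h₂
  | next d φ ih =>
    obtain ⟨S, i, hi⟩ := ih
    refine ⟨S.adjoin (finVal lam (next d φ)) 0 (Or.inl rfl) rfl
      fun a => subset_latticeClosure (Or.inr ⟨0, i, Or.inl rfl, funext fun v => ?_⟩), none, rfl⟩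
    simp [finVal, nextFn, hi]
  | untl d φ ψ ih₁ ih₂ =>
    obtain ⟨S, i, hi⟩ := ih₁
    obtain ⟨T, j, hj⟩ := ih₂
    refine ⟨(S.sum T).adjoin (finVal lam (untl d φ ψ)) 0 (Or.inl rfl) rfl fun a => ?_, none, rfl⟩
    have h₁ := latticeClosure_mono (Set.subset_insert (fun v => 0 + lam * finVal lam (untl d φ ψ) v)
      _) ((S.sum T).fn_cons_mem_gen (Sum.inl i) a)
    have h₂ := latticeClosure_mono (Set.subset_insert (fun v => 0 + lam * finVal lam (untl d φ ψ) v)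
      _) ((S.sum T).fn_cons_mem_gen (Sum.inr j) a)
    have h₀ : (fun v => lam * finVal lam (untl d φ ψ) v) ∈ latticeClosure
        (insert (fun v => 0 + lam * finVal lam (untl d φ ψ) v) (S.sum T).gen) :=
      subset_latticeClosure (Or.inl (by simp))
    simp only [WeakSystem.sum, Sum.elim_inl, Sum.elim_inr, hi, hj] at h₁ h₂
    exact isSublattice_latticeClosure.supClosed h₂ (isSublattice_latticeClosure.infClosed h₁ h₀)

/-! ### Paths and unrolling -/

namespace WeakSystem

variable {A : Type*} {lam : ℝ}

theorem fn_mem_bounds (S : WeakSystem A lam) (h₀ : 0 ≤ lam) (h₁ : lam ≤ 1) (i : S.ι) (v : List A) :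
    0 ≤ S.fn i v ∧ S.fn i v ≤ 1 - lam ^ v.length := by
  induction v generalizing i with
  | nil => simp [S.fn_nil]
  | cons a v ih =>
    refine latticeClosure_min
      (t := {g : List A → ℝ | 0 ≤ g v ∧ g v ≤ 1 - lam ^ (v.length + 1)}) ?_ ?_
      (S.fn_cons_mem_gen i a)
    · rintro g ⟨c, j, hc, rfl⟩
      obtain ⟨h₂, h₃⟩ := ih j
      have hmul := mul_nonneg h₀ h₂
      have hmul' := mul_le_mul_of_nonneg_left h₃ h₀
      have hpow : lam ^ (v.length + 1) = lam * lam ^ v.length := pow_succ' _ _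
      rcases hc with rfl | rfl <;> constructor <;> simp only [hpow] <;> linarith
    · exact ⟨fun g hg h hh => ⟨le_max_of_le_left hg.1, max_le hg.2 hh.2⟩,
        fun g hg h hh => ⟨le_min hg.1 hh.1, min_le_of_left_le hg.2⟩⟩

/-- Each letter after the prefix `w` adds at least `0` and, discounted, at most `1 - lam`. -/
theorem fn_append_bounds (S : WeakSystem A lam) (h₀ : 0 ≤ lam) (h₁ : lam ≤ 1) (i : S.ι)
    (w v : List A) : S.fn i w ≤ S.fn i (w ++ v) ∧
      S.fn i (w ++ v) ≤ S.fn i w + lam ^ w.length * (1 - lam ^ v.length) := by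
  induction w generalizing i with
  | nil => simpa [S.fn_nil] using S.fn_mem_bounds h₀ h₁ i v
  | cons a w ih =>
    refine latticeClosure_min (t := {g : List A → ℝ | g w ≤ g (w ++ v) ∧
      g (w ++ v) ≤ g w + lam ^ (w.length + 1) * (1 - lam ^ v.length)}) ?_ ?_
      (S.fn_cons_mem_gen i a)
    · rintro g ⟨c, j, -, rfl⟩
      obtain ⟨h₂, h₃⟩ := ih j
      exact ⟨add_le_add_right (mul_le_mul_of_nonneg_left h₂ h₀) c,
        (add_le_add_right (mul_le_mul_of_nonneg_left h₃ h₀) c).trans_eq (by ring)⟩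
    · refine ⟨fun g hg h hh => ⟨max_le_max hg.1 hh.1, ?_⟩,
        fun g hg h hh => ⟨min_le_min hg.1 hh.1, ?_⟩⟩
      · simp only [Pi.sup_apply]
        rw [← max_add_add_right]
        exact max_le_max hg.2 hh.2
      · simp only [Pi.inf_apply]
        rw [← min_add_add_right]
        exact min_le_min hg.2 hh.2

/-- `I` is an infinite path through the indices of the system and `C` the sequence of the weights
of its steps. -/
def IsPath (S : WeakSystem A lam) (I : ℕ → S.ι) (C : ℕ → ℝ) : Prop :=
  ∀ t, WeakStep lam S.rk S.loop (I t) (C t) (I (t + 1))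

end WeakSystem

/-- The discounted sum of the first `n` weights. -/
noncomputable def weight (lam : ℝ) (C : ℕ → ℝ) (n : ℕ) : ℝ := ∑ t ∈ Finset.range n, lam ^ t * C t

theorem weight_zero (lam : ℝ) (C : ℕ → ℝ) : weight lam C 0 = 0 := by simp [weight]

theorem weight_succ (lam : ℝ) (C : ℕ → ℝ) (n : ℕ) :
    weight lam C (n + 1) = weight lam C n + lam ^ n * C n := by
  simp [weight, Finset.sum_range_succ]

theorem weight_succ' (lam : ℝ) (C : ℕ → ℝ) (n : ℕ) :
    weight lam C (n + 1) = C 0 + lam * weight lam (fun t => C (t + 1)) n := by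
  simp only [weight, Finset.sum_range_succ', Finset.mul_sum]
  rw [add_comm]
  simp only [pow_zero, one_mul]
  congr 1
  exact Finset.sum_congr rfl fun t _ => by ring

theorem weight_le_weight_add {lam : ℝ} (h₀ : 0 ≤ lam) {C : ℕ → ℝ} (hC : ∀ t, 0 ≤ C t) (a b : ℕ) :
    weight lam C a ≤ weight lam C (a + b) := by
  induction b with
  | zero => simp
  | succ b ih =>
    rw [← add_assoc, weight_succ]
    linarith [mul_nonneg (pow_nonneg h₀ (a + b)) (hC (a + b))]

theorem weight_add_le {lam : ℝ} (h₀ : 0 ≤ lam) {C : ℕ → ℝ} (hC : ∀ t, C t ≤ 1 - lam) (a b : ℕ) :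
    weight lam C (a + b) + lam ^ (a + b) ≤ weight lam C a + lam ^ a := by
  induction b with
  | zero => simp
  | succ b ih =>
    rw [← add_assoc, weight_succ, pow_succ]
    nlinarith [mul_le_mul_of_nonneg_left (hC (a + b)) (pow_nonneg h₀ (a + b))]

theorem weight_add_of_eq_zero {lam : ℝ} {C : ℕ → ℝ} {a b : ℕ}
    (hC : ∀ t, a ≤ t → t < a + b → C t = 0) : weight lam C (a + b) = weight lam C a := by
  induction b with
  | zero => simp
  | succ b ih =>
    rw [← add_assoc, weight_succ, hC (a + b) (by omega) (by omega), mul_zero, add_zero]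
    exact ih fun t h₁ h₂ => hC t h₁ (by omega)

theorem weight_add_of_eq_one_sub {lam : ℝ} {C : ℕ → ℝ} {a b : ℕ}
    (hC : ∀ t, a ≤ t → t < a + b → C t = 1 - lam) :
    weight lam C (a + b) + lam ^ (a + b) = weight lam C a + lam ^ a := by
  induction b with
  | zero => simp
  | succ b ih =>
    rw [← add_assoc, weight_succ, hC (a + b) (by omega) (by omega),
      ← ih fun t h₁ h₂ => hC t h₁ (by omega)]
    ring

namespace WeakSystem

variable {A : Type*} {lam : ℝ} {S : WeakSystem A lam} {I : ℕ → S.ι} {C : ℕ → ℝ}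

theorem IsPath.nonneg (h : S.IsPath I C) (h₁ : lam ≤ 1) (t : ℕ) : 0 ≤ C t := by
  rcases S.step_weight (h t) with h | h <;> rw [h]
  linarith

theorem IsPath.le_one_sub (h : S.IsPath I C) (h₁ : lam ≤ 1) (t : ℕ) : C t ≤ 1 - lam := by
  rcases S.step_weight (h t) with h | h <;> rw [h]
  linarith

theorem IsPath.rk_antitone (h : S.IsPath I C) : Antitone fun t => S.rk (I t) :=
  antitone_nat_of_succ_le fun t => by
    rcases h t with ⟨h, -⟩ | ⟨h, -⟩
    exacts [(congrArg S.rk h).le, h.le]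

/-- A path that returns to an index has only taken the loop at that index. -/
theorem IsPath.eq_loop (h : S.IsPath I C) {a b : ℕ} (hab : I (a + b) = I a) {t : ℕ} (hat : a ≤ t)
    (htb : t < a + b) : C t = S.loop (I a) := by
  have hrk : ∀ s, a ≤ s → s ≤ a + b → S.rk (I s) = S.rk (I a) := fun s h₁ h₂ =>
    le_antisymm (h.rk_antitone h₁) ((congrArg S.rk hab).symm.le.trans (h.rk_antitone h₂))
  have hloop : ∀ s, a ≤ s → s < a + b → I (s + 1) = I s ∧ C s = S.loop (I s) := fun s h₁ h₂ => by
    rcases h s with h' | ⟨h', -⟩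
    · exact h'
    · have e₁ := hrk s h₁ h₂.le
      have e₂ := hrk (s + 1) (by omega) h₂
      omega
  have hI : ∀ k, a + k < a + b → I (a + k) = I a := fun k => by
    induction k with
    | zero => simp
    | succ k ih =>
      intro hk
      rw [← ih (by omega), ← add_assoc, (hloop (a + k) (by omega) (by omega)).1]
  obtain ⟨k, rfl⟩ := Nat.exists_eq_add_of_le hat
  rw [(hloop _ hat htb).2, hI k htb]

/-- After a prefix `w`, a member of a weak system is a lattice polynomial in the members again,
with coefficients the weights of the paths of length `|w|`. -/
theorem fn_append_mem (S : WeakSystem A lam) (h₀ : 0 ≤ lam) (i : S.ι) (w : List A) :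
    (fun v => S.fn i (w ++ v)) ∈ latticeClosure {g | ∃ I C, S.IsPath I C ∧ I 0 = i ∧
      g = fun v => weight lam C w.length + lam ^ w.length * S.fn (I w.length) v} := by
  induction w generalizing i with
  | nil =>
    refine subset_latticeClosure ⟨fun _ => i, fun _ => S.loop i, fun t => Or.inl ⟨rfl, rfl⟩, rfl,
      ?_⟩
    simp [weight_zero]
  | cons a w ih =>
    refine map_mem_latticeClosure (Φ := fun (g : List A → ℝ) (v : List A) => g (w ++ v))
      (fun _ _ => rfl) (fun _ _ => rfl) ?_ (S.fn_cons i a)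
    rintro g ⟨c, j, hj, rfl⟩
    have hmono : Monotone fun x : ℝ => c + lam * x :=
      fun x y hxy => add_le_add_right (mul_le_mul_of_nonneg_left hxy h₀) c
    refine map_mem_latticeClosure (Φ := fun (g : List A → ℝ) (v : List A) => c + lam * g v)
      (fun g h => funext fun v => hmono.map_max) (fun g h => funext fun v => hmono.map_min)
      ?_ (ih j)
    rintro g ⟨I, C, hIC, hI, rfl⟩
    refine subset_latticeClosure ⟨fun t => t.casesOn i I, fun t => t.casesOn c C, ?_, rfl, ?_⟩
    · rintro (_ | t)
      · simpa [hI] using hj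
      · exact hIC t
    · funext v
      simp only [List.length_cons, weight_succ']
      change c + lam * (weight lam C w.length + lam ^ w.length * S.fn (I w.length) v) =
        c + lam * weight lam C w.length + lam ^ (w.length + 1) * S.fn (I w.length) v
      ring

/-- The value of a finite word is the weight of one of the paths of its length. -/
theorem exists_weight_eq (S : WeakSystem A lam) (h₀ : 0 ≤ lam) (i : S.ι) (w : List A) :
    ∃ I C, S.IsPath I C ∧ I 0 = i ∧ weight lam C w.length = S.fn i w := by
  have h := latticeClosure_min (t := {g : List A → ℝ | ∃ I C, S.IsPath I C ∧ I 0 = i ∧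
    weight lam C w.length = g []}) ?_ ?_ (S.fn_append_mem h₀ i w)
  · simpa only [Set.mem_ofPred_eq, List.append_nil] using h
  · rintro g ⟨I, C, hIC, hI, rfl⟩
    exact ⟨I, C, hIC, hI, by simp [S.fn_nil]⟩
  · refine ⟨fun g hg h hh => ?_, fun g hg h hh => ?_⟩
    · rcases max_choice (g []) (h []) with e | e
      · simpa only [Set.mem_ofPred_eq, Pi.sup_apply, e] using hg
      · simpa only [Set.mem_ofPred_eq, Pi.sup_apply, e] using hh
    · rcases min_choice (g []) (h []) with e | e
      · simpa only [Set.mem_ofPred_eq, Pi.inf_apply, e] using hg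
      · simpa only [Set.mem_ofPred_eq, Pi.inf_apply, e] using hh

end WeakSystem

/-! ### Finiteness of the relevant gaps -/

/-- The effect of one step on the gap between two paths whose weights in this step differ
by `e`. -/
noncomputable def gapStep (lam e x : ℝ) : ℝ := (x + e) / lam

/-- The gap between two sequences of weights after `n` steps, in units of `lam ^ n`. -/
noncomputable def gap (lam : ℝ) (C C' : ℕ → ℝ) (n : ℕ) : ℝ :=
  (weight lam C n - weight lam C' n) / lam ^ n

theorem gap_succ {lam : ℝ} (h₀ : 0 < lam) (C C' : ℕ → ℝ) (n : ℕ) :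
    gap lam C C' (n + 1) = gapStep lam (C n - C' n) (gap lam C C' n) := by
  have := h₀.ne'
  simp only [gap, gapStep, weight_succ]
  field_simp
  ring

theorem abs_lt_one_of_gapStep {lam e x : ℝ} (h₀ : 0 < lam) (he : |e| ≤ 1 - lam)
    (h : |gapStep lam e x| < 1) : |x| < 1 := by
  rw [gapStep, abs_div, abs_of_pos h₀, div_lt_one h₀] at h
  rw [abs_lt] at h ⊢
  rw [abs_le] at he
  constructor <;> linarith

/-- The map `x ↦ (x + e) / lam` is expanding, hence its orbits stay in `(-1,1)` only for finitely
many steps, or at its fixed point. -/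
theorem finite_gapStep_orbit {lam : ℝ} (h₀ : 0 < lam) (h₁ : lam < 1) (e x : ℝ) :
    {y | |y| < 1 ∧ ∃ s : ℕ, y = (gapStep lam e)^[s] x}.Finite := by
  have hne : 1 - lam ≠ 0 := by linarith
  set p : ℝ := -e / (1 - lam) with hp
  have hiter : ∀ s : ℕ, (gapStep lam e)^[s] x = p + (x - p) * (lam⁻¹) ^ s := fun s => by
    induction s with
    | zero => simp
    | succ s ih =>
      rw [Function.iterate_succ_apply', ih, gapStep, hp, pow_succ]
      have := h₀.ne'
      field_simp
      ring
  by_cases hx : x = p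
  · refine (Set.finite_singleton p).subset ?_
    rintro y ⟨-, s, rfl⟩
    rw [Set.mem_singleton_iff, hiter, sub_eq_zero.2 hx, zero_mul, add_zero]
  · have hpos : 0 < |x - p| := abs_pos.2 (sub_ne_zero.2 hx)
    obtain ⟨N, hN⟩ := Filter.eventually_atTop.1 ((tendsto_pow_atTop_atTop_of_one_lt
      ((one_lt_inv₀ h₀).2 h₁)).eventually_ge_atTop ((1 + |p|) / |x - p|))
    refine ((Finset.range N).finite_toSet.image fun s => (gapStep lam e)^[s] x).subset ?_
    rintro y ⟨hy, s, rfl⟩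
    refine ⟨s, ?_, rfl⟩
    by_contra hs
    have h := hN s (by simpa using hs)
    rw [div_le_iff₀ hpos] at h
    have h₂ : |(x - p) * lam⁻¹ ^ s| ≤ |(gapStep lam e)^[s] x| + |p| := by
      rw [hiter s]
      simpa using abs_sub (p + (x - p) * lam⁻¹ ^ s) p
    rw [abs_mul, abs_of_pos (pow_pos (inv_pos.2 h₀) s)] at h₂
    linarith

/-- The possible differences of the weights of two steps. -/
def stepDiff (lam : ℝ) : Set ℝ := {0, 1 - lam, -(1 - lam)}

theorem finite_stepDiff (lam : ℝ) : (stepDiff lam).Finite := by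
  simp [stepDiff]

theorem sub_mem_stepDiff {lam c c' : ℝ} (hc : c = 0 ∨ c = 1 - lam) (hc' : c' = 0 ∨ c' = 1 - lam) :
    c - c' ∈ stepDiff lam := by
  rcases hc with rfl | rfl <;> rcases hc' with rfl | rfl <;> simp [stepDiff]

theorem abs_le_of_mem_stepDiff {lam e : ℝ} (h₁ : lam ≤ 1) (he : e ∈ stepDiff lam) :
    |e| ≤ 1 - lam := by
  have h : 0 ≤ 1 - lam := by linarith
  rcases he with rfl | rfl | rfl
  · simpa using h
  · rw [abs_of_nonneg h]
  · rw [abs_neg, abs_of_nonneg h]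

/-- The gaps in `(-1,1)` that are reached from a gap in `X` by repetition of a single step. -/
def gapOrbit (lam : ℝ) (X : Set ℝ) : Set ℝ :=
  {y | ∃ x ∈ X, ∃ e ∈ stepDiff lam, |y| < 1 ∧ ∃ s : ℕ, y = (gapStep lam e)^[s] x}

/-- The gaps that are reached from `0` in `m` phases, each of which repeats one step, stays in
`(-1,1)` and ends with one arbitrary step. -/
def gapEntry (lam : ℝ) : ℕ → Set ℝ
  | 0 => {0}
  | m + 1 => {z | ∃ y ∈ gapOrbit lam (gapEntry lam m), ∃ e ∈ stepDiff lam, z = gapStep lam e y}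

theorem finite_gapOrbit {lam : ℝ} (h₀ : 0 < lam) (h₁ : lam < 1) {X : Set ℝ} (hX : X.Finite) :
    (gapOrbit lam X).Finite := by
  refine (hX.biUnion fun x _ => (finite_stepDiff lam).biUnion fun e _ =>
    finite_gapStep_orbit h₀ h₁ e x).subset ?_
  rintro y ⟨x, hx, e, he, hy⟩
  exact Set.mem_biUnion hx (Set.mem_biUnion he hy)

theorem finite_gapEntry {lam : ℝ} (h₀ : 0 < lam) (h₁ : lam < 1) (m : ℕ) :
    (gapEntry lam m).Finite := by
  induction m with
  | zero => exact Set.finite_singleton 0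
  | succ m ih =>
    refine ((finite_gapOrbit h₀ h₁ ih).image2 (fun y e => gapStep lam e y)
      (finite_stepDiff lam)).subset ?_
    rintro z ⟨y, hy, e, he, rfl⟩
    exact ⟨y, hy, e, he, rfl⟩

namespace WeakSystem

variable {A : Type*} {lam : ℝ}

/-- The gaps in `(-1,1)` between two paths of the system. -/
def gaps (S : WeakSystem A lam) : Set ℝ :=
  {x | |x| < 1 ∧ ∃ I C I' C' n, S.IsPath I C ∧ S.IsPath I' C' ∧ x = gap lam C C' n}

/-- Every step that is not a loop on both paths lowers the sum of the ranks, and thus the number of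
phases is bounded by the initial ranks. -/
theorem exists_gapEntry (S : WeakSystem A lam) (h₀ : 0 < lam) (h₁ : lam < 1) {I I' : ℕ → S.ι}
    {C C' : ℕ → ℝ} (h : S.IsPath I C) (h' : S.IsPath I' C') (n : ℕ) (hn : |gap lam C C' n| < 1) :
    ∃ m s : ℕ, m + (S.rk (I n) + S.rk (I' n)) ≤ S.rk (I 0) + S.rk (I' 0) ∧
      ∃ x ∈ gapEntry lam m,
        gap lam C C' n = (gapStep lam (S.loop (I n) - S.loop (I' n)))^[s] x := by
  induction n with
  | zero => exact ⟨0, 0, by simp, 0, rfl, by simp [gap, weight_zero]⟩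
  | succ n ih =>
    have hd := sub_mem_stepDiff (S.step_weight (h n)) (S.step_weight (h' n))
    rw [gap_succ h₀] at hn ⊢
    have hn' := abs_lt_one_of_gapStep h₀ (abs_le_of_mem_stepDiff h₁.le hd) hn
    obtain ⟨m, s, hm, x, hx, hgap⟩ := ih hn'
    have hlow : S.rk (I (n + 1)) + S.rk (I' (n + 1)) < S.rk (I n) + S.rk (I' n) →
        ∃ m s : ℕ, m + (S.rk (I (n + 1)) + S.rk (I' (n + 1))) ≤ S.rk (I 0) + S.rk (I' 0) ∧
          ∃ x ∈ gapEntry lam m, gapStep lam (C n - C' n) (gap lam C C' n) =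
            (gapStep lam (S.loop (I (n + 1)) - S.loop (I' (n + 1))))^[s] x := fun hlt =>
      ⟨m + 1, 0, by omega, _, ⟨_, ⟨x, hx, _, sub_mem_stepDiff (S.loop_mem _) (S.loop_mem _), hn', s,
        hgap⟩, _, hd, rfl⟩, rfl⟩
    have hr := h.rk_antitone n.le_succ
    have hr' := h'.rk_antitone n.le_succ
    simp only [Nat.succ_eq_add_one] at hr hr'
    rcases h n with ⟨e₁, e₂⟩ | ⟨hlt, -⟩
    · rcases h' n with ⟨e₃, e₄⟩ | ⟨hlt, -⟩
      · refine ⟨m, s + 1, by rwa [e₁, e₃], x, hx, ?_⟩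
        rw [Function.iterate_succ_apply', e₁, e₃, ← hgap, e₂, e₄]
      · exact hlow (by omega)
    · exact hlow (by omega)

theorem finite_gaps (S : WeakSystem A lam) (h₀ : 0 < lam) (h₁ : lam < 1) : S.gaps.Finite := by
  obtain ⟨M, hM⟩ := S.exists_rk_lt
  refine ((Finset.range (M + M)).finite_toSet.biUnion fun m _ =>
    finite_gapOrbit h₀ h₁ (finite_gapEntry h₀ h₁ m)).subset ?_
  rintro x ⟨hx, I, C, I', C', n, h, h', rfl⟩
  obtain ⟨m, s, hm, y, hy, hgap⟩ := S.exists_gapEntry h₀ h₁ h h' n hx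
  have := hM (I 0)
  have := hM (I' 0)
  exact Set.mem_biUnion (by simp; omega)
    ⟨y, hy, _, sub_mem_stepDiff (S.loop_mem _) (S.loop_mem _), hx, s, hgap⟩

end WeakSystem

/-! ### Residuals -/

/-- The residual of `f` after the prefix `w`: the increase of `f` caused by the letters that follow
`w`, in units of `lam ^ |w|`. -/
noncomputable def prefixResidual {A : Type*} (lam : ℝ) (f : List A → ℝ) (w v : List A) : ℝ :=
  (f (w ++ v) - f w) / lam ^ w.length

theorem prefixResidual_apply_nil {A : Type*} (lam : ℝ) (f : List A → ℝ) (w : List A) :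
    prefixResidual lam f w [] = 0 := by
  simp [prefixResidual]

theorem prefixResidual_comp {A : Type*} {lam : ℝ} (h₀ : 0 < lam) (f : List A → ℝ)
    (w x : List A) :
    prefixResidual lam (prefixResidual lam f w) x = prefixResidual lam f (w ++ x) := by
  funext v
  have := h₀.ne'
  simp only [prefixResidual, List.append_assoc, List.length_append, pow_add]
  field_simp
  ring

theorem apply_append {A : Type*} {lam : ℝ} (h₀ : 0 < lam) (f : List A → ℝ) (w v : List A) :
    f (w ++ v) = f w + lam ^ w.length * prefixResidual lam f w v := by
  have := h₀.ne'
  rw [prefixResidual]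
  field_simp
  ring

namespace WeakSystem

variable {A : Type*} {lam : ℝ}

theorem prefixResidual_fn_bounds (S : WeakSystem A lam) (h₀ : 0 < lam) (h₁ : lam ≤ 1) (i : S.ι)
    (w v : List A) : 0 ≤ prefixResidual lam (S.fn i) w v ∧
      prefixResidual lam (S.fn i) w v ≤ 1 - lam ^ v.length := by
  obtain ⟨h₂, h₃⟩ := S.fn_append_bounds h₀.le h₁ i w v
  have hpow := pow_pos h₀ w.length
  rw [prefixResidual, div_le_iff₀ hpow]
  exact ⟨div_nonneg (by linarith) hpow.le, by linarith⟩

/-- A member of a weak system has finitely many residuals: they are lattice polynomials in the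
truncations of the functions `x + fn j`, where `x` is the gap between two paths. Gaps outside
`(-1,1)` truncate to the same functions as `1` and `-1`. -/
theorem finite_range_prefixResidual (S : WeakSystem A lam) (h₀ : 0 < lam) (h₁ : lam < 1) (i : S.ι) :
    (Set.range (prefixResidual lam (S.fn i))).Finite := by
  have := S.finite_ι
  let T : Set (List A → ℝ) :=
    Set.image2 (fun x j => fun v => max 0 (min (1 - lam ^ v.length) (x + S.fn j v)))
      (insert 1 (insert (-1) S.gaps)) Set.univ
  have hT : T.Finite := (((S.finite_gaps h₀ h₁).insert _).insert _).image2 _ Set.finite_univ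
  refine hT.latticeClosure.subset ?_
  rintro _ ⟨w, rfl⟩
  have hpow := pow_pos h₀ w.length
  have hmono : ∀ v : List A, Monotone fun x : ℝ =>
      max 0 (min (1 - lam ^ v.length) ((x - S.fn i w) / lam ^ w.length)) := fun v x y hxy =>
    max_le_max le_rfl (min_le_min le_rfl (div_le_div_of_nonneg_right (by linarith) hpow.le))
  have htrunc : prefixResidual lam (S.fn i) w = fun v =>
      max 0 (min (1 - lam ^ v.length) ((S.fn i (w ++ v) - S.fn i w) / lam ^ w.length)) := by
    funext v
    obtain ⟨h₂, h₃⟩ := S.prefixResidual_fn_bounds h₀ h₁.le i w v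
    change _ = max 0 (min _ (prefixResidual lam (S.fn i) w v))
    rw [min_eq_right h₃, max_eq_right h₂]
  rw [htrunc]
  refine map_mem_latticeClosure (Φ := fun (g : List A → ℝ) (v : List A) =>
      max 0 (min (1 - lam ^ v.length) ((g v - S.fn i w) / lam ^ w.length)))
    (fun g h => funext fun v => (hmono v).map_max) (fun g h => funext fun v => (hmono v).map_min)
    ?_ (S.fn_append_mem h₀.le i w)
  rintro g ⟨I, C, hIC, hI, rfl⟩
  obtain ⟨I', C', hIC', -, hw⟩ := S.exists_weight_eq h₀.le i w
  set x := gap lam C C' w.length with hx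
  set j := I w.length
  have hsplit : ∀ v, (weight lam C w.length + lam ^ w.length * S.fn j v - S.fn i w) /
      lam ^ w.length = x + S.fn j v := fun v => by
    rw [hx, gap, hw]
    field_simp
    ring
  simp only [hsplit]
  refine subset_latticeClosure ?_
  by_cases hlt : |x| < 1
  · exact ⟨x, Or.inr (Or.inr ⟨hlt, I, C, I', C', _, hIC, hIC', rfl⟩), j, trivial, rfl⟩
  · rcases le_abs'.1 (not_lt.1 hlt) with h | h
    · refine ⟨-1, Or.inr (Or.inl rfl), j, trivial, funext fun v => ?_⟩
      obtain ⟨h₂, h₃⟩ := S.fn_mem_bounds h₀.le h₁.le j v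
      have hv := pow_pos h₀ v.length
      dsimp only
      rw [max_eq_left (min_le_of_right_le (by linarith)),
        max_eq_left (min_le_of_right_le (by linarith))]
    · refine ⟨1, Or.inl rfl, j, trivial, funext fun v => ?_⟩
      obtain ⟨h₂, h₃⟩ := S.fn_mem_bounds h₀.le h₁.le j v
      have hv := pow_pos h₀ v.length
      dsimp only
      rw [min_eq_left (by linarith), min_eq_left (by linarith)]

/-- If the residual after `w` recurs after `w ++ x`, then the letters of `x` add the least or the
greatest possible amount. With `V` the discounted sum of the rewards along `x, x, x, …`, a path
whose weight is the value of `w ++ x ^ N`, for `N` large, visits the same index with the same gap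
at two of the prefixes `w ++ x ^ j`. Between them, it takes a loop only, which forces the gap to be
`V` (for loop weight `0`) or `V - 1` (for loop weight `1 - lam`). In the first case, the weight of
the path is from then on at least the value of the prefix, with equality only if `V ≤ 0`; in the
second case it is at most the value, with equality only if `V ≥ 1`. -/
theorem prefixResidual_cycle (S : WeakSystem A lam) (h₀ : 0 < lam) (h₁ : lam < 1) (i : S.ι)
    {w x : List A} (hcyc : prefixResidual lam (S.fn i) (w ++ x) = prefixResidual lam (S.fn i) w) :
    prefixResidual lam (S.fn i) w x = 0 ∨ prefixResidual lam (S.fn i) w x = 1 - lam ^ x.length := by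
  have := S.finite_ι
  rcases eq_or_ne x [] with rfl | hx
  · exact Or.inl (prefixResidual_apply_nil _ _ _)
  have hm : 0 < x.length := List.length_pos_of_ne_nil hx
  have hden : 0 < 1 - lam ^ x.length := sub_pos.2 (pow_lt_one₀ h₀.le h₁ hm.ne')
  set V := prefixResidual lam (S.fn i) w x / (1 - lam ^ x.length) with hV
  have hVx : prefixResidual lam (S.fn i) w x = V * (1 - lam ^ x.length) := by
    rw [hV]
    field_simp
  obtain ⟨hb₀, hb₁⟩ := S.prefixResidual_fn_bounds h₀ h₁.le i w x
  let u : ℕ → List A := fun j => w ++ (List.replicate j x).flatten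
  have hu_succ : ∀ j, u (j + 1) = u j ++ x := fun j => by
    simp [u, List.replicate_succ']
  have hu_add : ∀ j k, ∃ y, u (j + k) = u j ++ y := fun j k =>
    ⟨(List.replicate k x).flatten, by simp [u, ← List.replicate_append_replicate]⟩
  have hu_len : ∀ j, (u j).length = w.length + j * x.length := fun j => by
    simp [u]
  have hu_res : ∀ j, prefixResidual lam (S.fn i) (u j) = prefixResidual lam (S.fn i) w := by
    intro j
    induction j with
    | zero => simp [u]
    | succ j ih => rw [hu_succ, ← prefixResidual_comp h₀, ih,
        prefixResidual_comp h₀, hcyc]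
  set B := S.fn i w + lam ^ w.length * V with hB
  have hval : ∀ j, S.fn i (u j) = B - V * lam ^ (u j).length := fun j => by
    induction j with
    | zero => simp [u, hB]; ring
    | succ j ih =>
      rw [hu_succ, apply_append h₀ (S.fn i), hu_res, hVx, ih,
        List.length_append (as := u j), pow_add]
      ring
  obtain ⟨N, hN⟩ : ∃ N, (((S.finite_gaps h₀ h₁).prod
      (Set.finite_univ (α := S.ι))).toFinset).card < N := ⟨_, Nat.lt_succ_self _⟩
  obtain ⟨I, C, hIC, hI, hC⟩ := S.exists_weight_eq h₀.le i (u N)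
  -- the gap between the path and the value of the prefix `u j`
  let D : ℕ → ℝ := fun j => (weight lam C (u j).length - S.fn i (u j)) / lam ^ (u j).length
  have hle : ∀ j ≤ N, ∃ k, (u N).length = (u j).length + k := fun j hj =>
    Nat.exists_eq_add_of_le (by rw [hu_len, hu_len]; gcongr)
  have hmem : ∀ j ≤ N, D j ∈ S.gaps := fun j hj => by
    obtain ⟨k, hk⟩ := hle j hj
    obtain ⟨l, hl⟩ := Nat.exists_eq_add_of_le hj
    obtain ⟨y, hy⟩ := hu_add j l
    rw [← hl] at hy
    obtain ⟨I', C', hIC', -, hC'⟩ := S.exists_weight_eq h₀.le i (u j)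
    refine ⟨?_, I, C, I', C', (u j).length, hIC, hIC', by rw [gap, hC']⟩
    have e₁ := weight_le_weight_add h₀.le (hIC.nonneg h₁.le) (u j).length k
    have e₂ := weight_add_le h₀.le (hIC.le_one_sub h₁.le) (u j).length k
    obtain ⟨e₃, e₄⟩ := S.fn_append_bounds h₀.le h₁.le i (u j) y
    rw [← hk, hC] at e₁ e₂
    rw [← hy] at e₃ e₄
    have hpow := pow_pos h₀ (u j).length
    have hpow' := pow_pos h₀ (u N).length
    have hpow'' := mul_pos hpow (pow_pos h₀ y.length)
    rw [abs_lt, lt_div_iff₀ hpow, div_lt_iff₀ hpow]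
    constructor <;> linarith
  obtain ⟨a, b, hab, hbN, hD, hIab⟩ : ∃ a b, a < b ∧ b ≤ N ∧ D a = D b ∧
      I (u a).length = I (u b).length := by
    obtain ⟨a, ha, b, hb, hne, hab⟩ := Finset.exists_ne_map_eq_of_card_lt_of_maps_to
      (s := Finset.range (N + 1)) (f := fun j => (D j, I (u j).length))
      (by rw [Finset.card_range]; exact hN.trans (Nat.lt_succ_self N))
      (fun j hj => by
        simpa using hmem j (Nat.lt_succ_iff.1 (by simpa using hj)))
    rw [Finset.mem_range] at ha hb
    obtain ⟨e₁, e₂⟩ := Prod.mk.inj hab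
    rcases lt_or_gt_of_ne hne with h | h
    · exact ⟨a, b, h, by omega, e₁, e₂⟩
    · exact ⟨b, a, h, by omega, e₁.symm, e₂.symm⟩
  have hlen : (u a).length < (u b).length := by
    rw [hu_len, hu_len]
    gcongr
  obtain ⟨k, hk⟩ := Nat.exists_eq_add_of_le hlen.le
  obtain ⟨k', hk'⟩ := hle b hbN
  rw [hk] at hIab
  have hloop := fun t => hIC.eq_loop hIab.symm (t := t)
  have hpa := pow_pos h₀ (u a).length
  have hpb := pow_pos h₀ (u b).length
  have hpN := pow_pos h₀ (u N).length
  have hpow : lam ^ (u b).length < lam ^ (u a).length := pow_lt_pow_right_of_lt_one₀ h₀ h₁ hlen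
  have hcross : (weight lam C (u a).length - S.fn i (u a)) * lam ^ (u b).length =
      (weight lam C (u b).length - S.fn i (u b)) * lam ^ (u a).length := by
    have := hD
    simp only [D] at this
    rwa [div_eq_div_iff hpa.ne' hpb.ne'] at this
  rw [hval, hval] at hcross
  have hvalN := hval N
  rcases S.loop_mem (I (u a).length) with hc | hc
  · left
    have hw : weight lam C (u b).length = weight lam C (u a).length := by
      rw [hk]
      exact weight_add_of_eq_zero fun t h₂ h₃ => (hloop t h₂ h₃).trans hc
    have hwB : weight lam C (u b).length = B := by
      have : (weight lam C (u b).length - B) * (lam ^ (u a).length - lam ^ (u b).length) = 0 := by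
        rw [← hw] at hcross
        linear_combination -hcross
      rcases mul_eq_zero.1 this with h | h <;> linarith
    have hend := weight_le_weight_add h₀.le (hIC.nonneg h₁.le) (u b).length k'
    rw [← hk', hC, hvalN, hwB] at hend
    have hV₀ : V ≤ 0 := by
      by_contra hpos
      have := mul_pos (not_le.1 hpos) hpN
      linarith
    have := mul_nonpos_of_nonpos_of_nonneg hV₀ hden.le
    linarith
  · right
    have hw : weight lam C (u b).length + lam ^ (u b).length =
        weight lam C (u a).length + lam ^ (u a).length := by
      rw [hk]
      exact weight_add_of_eq_one_sub fun t h₂ h₃ => (hloop t h₂ h₃).trans hc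
    have hwB : weight lam C (u b).length + lam ^ (u b).length = B := by
      have : (weight lam C (u b).length + lam ^ (u b).length - B) *
          (lam ^ (u a).length - lam ^ (u b).length) = 0 := by
        linear_combination -hcross - lam ^ (u b).length * hw
      rcases mul_eq_zero.1 this with h | h <;> linarith
    have hend := weight_add_le h₀.le (hIC.le_one_sub h₁.le) (u b).length k'
    rw [← hk', hC, hvalN, hwB] at hend
    have hV₁ : 1 ≤ V := by
      by_contra hlt
      have := mul_lt_mul_of_pos_right (not_le.1 hlt) hpN
      linarith
    have := mul_le_mul_of_nonneg_right hV₁ hden.le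
    linarith

end WeakSystem

/-! ### The reward machine of the residuals -/

/-- The classes of a preorder on a finite type can be numbered monotonically. -/
theorem exists_monotone_numbering {Q : Type*} [Finite Q] (r : Q → Q → Prop) (hrefl : ∀ q, r q q)
    (htrans : ∀ q₁ q₂ q₃, r q₁ q₂ → r q₂ q₃ → r q₁ q₃) :
    ∃ (L : ℕ) (b : Q → Fin L), Function.Surjective b ∧ (∀ q q', r q q' → b q ≤ b q') ∧
      ∀ q q', b q = b q' → r q q' := by
  classical
  let : Preorder Q := { le := r, le_refl := hrefl, le_trans := htrans }
  let E := LinearExtension (Antisymmetrization Q (· ≤ ·))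
  have : Finite E := inferInstanceAs (Finite (Quotient _))
  let := Fintype.ofFinite E
  let e : Fin (Fintype.card E) ≃o E := Fintype.orderIsoFinOfCardEq E rfl
  let cls : Q → E := fun q => toLinearExtension (toAntisymmetrization (· ≤ ·) q)
  refine ⟨_, fun q => e.symm (cls q), fun l => ?_, fun q q' h => ?_, fun q q' h => ?_⟩
  · obtain ⟨q, hq⟩ := Quotient.exists_rep (s := AntisymmRel.setoid Q (· ≤ ·)) (e l)
    exact ⟨q, (e.symm_apply_eq).2 hq⟩
  · exact e.symm.monotone (toLinearExtension.monotone (toAntisymmetrization_mono h))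
  · exact (Quotient.exact (s := AntisymmRel.setoid Q (· ≤ ·)) (e.symm.injective h)).1

/-- If both parts of a word are bounded by what they can contribute at most, then a value of `0` or
of the greatest possible amount is attained on both parts. -/
theorem extremal_append {A : Type*} {lam : ℝ} (h₀ : 0 < lam) {q : List A → ℝ} {x y : List A}
    (hx : 0 ≤ q x ∧ q x ≤ 1 - lam ^ x.length)
    (hy : 0 ≤ prefixResidual lam q x y ∧ prefixResidual lam q x y ≤ 1 - lam ^ y.length) :
    (q (x ++ y) = 0 → q x = 0 ∧ prefixResidual lam q x y = 0) ∧
    (q (x ++ y) = 1 - lam ^ (x ++ y).length →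
      q x = 1 - lam ^ x.length ∧ prefixResidual lam q x y = 1 - lam ^ y.length) := by
  have hpow := pow_pos h₀ x.length
  rw [apply_append h₀ q x y, List.length_append, pow_add]
  have h₁ := mul_nonneg hpow.le hy.1
  have h₂ := mul_le_mul_of_nonneg_left hy.2 hpow.le
  rw [mul_sub, mul_one] at h₂
  refine ⟨fun h => ⟨by linarith [hx.1], ?_⟩, fun h => ⟨by linarith [hx.2], ?_⟩⟩
  · have : lam ^ x.length * prefixResidual lam q x y = 0 := by linarith [hx.1]
    exact (mul_eq_zero.1 this).resolve_left hpow.ne'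
  · have : lam ^ x.length * prefixResidual lam q x y = lam ^ x.length * (1 - lam ^ y.length) := by
      linarith [hx.2]
    exact mul_left_cancel₀ hpow.ne' this

/-- The reward machine whose states are the residuals of `f`, for a function `f` with finitely many
residuals whose increase along each cycle of residuals is extremal. The blocks are the strongly
connected components. -/
theorem exists_rewardMachine {A : Type*} (d : Set.Ico (0 : ℝ) 1) (hd : 0 < (d : ℝ))
    (f : List A → ℝ) (hnil : f [] = 0)
    (hbounds : ∀ w v, 0 ≤ prefixResidual d f w v ∧ prefixResidual d f w v ≤ 1 - (d : ℝ) ^ v.length)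
    (hfin : (Set.range (prefixResidual d f)).Finite)
    (hcyc : ∀ w x, prefixResidual d f (w ++ x) = prefixResidual d f w →
      prefixResidual d f w x = 0 ∨ prefixResidual d f w x = 1 - (d : ℝ) ^ x.length) :
    ∃ R : RewardMachine A, R.discount = d ∧
      (∀ ρ n, ∑ t ∈ Finset.range n, (d : ℝ) ^ t * R.r (R.run ρ t) (ρ t) = f (wordPrefix ρ n)) ∧
      R.HasTypedPartition ∧ ∀ q σ, 0 ≤ R.r q σ ∧ R.r q σ ≤ 1 - (d : ℝ) := by
  have : Finite (Set.range (prefixResidual (d : ℝ) f)) := hfin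
  -- the states are renamed, as a reward machine has its states in the lowest universe
  obtain ⟨N, ⟨e⟩⟩ := Finite.exists_equiv_fin (Set.range (prefixResidual (d : ℝ) f))
  let st : Fin N → List A → ℝ := fun q => (e.symm q).1
  have hst : ∀ q, ∃ w, prefixResidual d f w = st q := fun q => (e.symm q).2
  have hinj : Function.Injective st := Subtype.val_injective.comp e.symm.injective
  have hstep : ∀ q x, ∃ q', st q' = prefixResidual d (st q) x := fun q x => by
    obtain ⟨w, hw⟩ := hst q
    exact ⟨e ⟨prefixResidual d f (w ++ x), w ++ x, rfl⟩, by
      simp only [st, Equiv.symm_apply_apply]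
      rw [← prefixResidual_comp hd, hw]⟩
  choose next hnext using hstep
  have hbd : ∀ q x, 0 ≤ st q x ∧ st q x ≤ 1 - (d : ℝ) ^ x.length := fun q x => by
    obtain ⟨w, hw⟩ := hst q
    rw [← hw]
    exact hbounds w x
  have hcyc' : ∀ q x, st (next q x) = st q → st q x = 0 ∨ st q x = 1 - (d : ℝ) ^ x.length :=
    fun q x h => by
      obtain ⟨w, hw⟩ := hst q
      rw [hnext, ← hw, prefixResidual_comp hd] at h
      rw [← hw]
      exact hcyc w x h
  have happ : ∀ q x y, next q (x ++ y) = next (next q x) y := fun q x y =>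
    hinj (by rw [hnext, hnext, hnext, prefixResidual_comp hd])
  have hnextnil : ∀ q, next q [] = q := fun q => hinj (by
    obtain ⟨w, hw⟩ := hst q
    rw [hnext, ← hw, prefixResidual_comp hd, List.append_nil])
  have hext : ∀ q x y, (st q (x ++ y) = 0 → st q x = 0 ∧ st (next q x) y = 0) ∧
      (st q (x ++ y) = 1 - (d : ℝ) ^ (x ++ y).length →
        st q x = 1 - (d : ℝ) ^ x.length ∧ st (next q x) y = 1 - (d : ℝ) ^ y.length) :=
    fun q x y => by
      rw [hnext]
      exact extremal_append hd (hbd q x) (by rw [← hnext]; exact hbd _ y)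
  obtain ⟨L, block, hsurj, hmono, hblock⟩ := exists_monotone_numbering
    (fun q q' : Fin N => ∃ x, next q x = q') (fun q => ⟨[], hnextnil q⟩) (by
      rintro q₁ q₂ q₃ ⟨x, rfl⟩ ⟨y, rfl⟩
      exact ⟨x ++ y, happ _ _ _⟩)
  -- any two transitions inside of a block lie on a common cycle
  have huniform : ∀ q a q' a', block (next q [a]) = block q → block q' = block q →
      block (next q' [a']) = block q →
      (st q [a] = 0 ∧ st q' [a'] = 0) ∨ (st q [a] = 1 - (d : ℝ) ∧ st q' [a'] = 1 - (d : ℝ)) := by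
    intro q a q' a' h₁ h₂ h₃
    obtain ⟨y, hy⟩ := hblock _ _ (h₁.trans h₂.symm)
    obtain ⟨z, hz⟩ := hblock _ _ h₃
    have e₁ := hext q [a] (y ++ ([a'] ++ z))
    have e₂ := hext (next q [a]) y ([a'] ++ z)
    have e₃ := hext q' [a'] z
    rw [hy] at e₂
    rcases hcyc' q ([a] ++ (y ++ ([a'] ++ z))) (by rw [happ, happ, hy, happ, hz]) with h | h
    · exact Or.inl ⟨(e₁.1 h).1, (e₃.1 (e₂.1 (e₁.1 h).2).2).1⟩
    · exact Or.inr ⟨by simpa using (e₁.2 h).1, by simpa using (e₃.2 (e₂.2 (e₁.2 h).2).2).1⟩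
  let R : RewardMachine A :=
    { Q := Fin N
      finite_Q := inferInstance
      δ := fun q a => next q [a]
      r := fun q a => st q [a]
      q₀ := e ⟨prefixResidual d f [], [], rfl⟩
      discount := d }
  have hrun : ∀ ρ n, st (R.run ρ n) = prefixResidual d f (wordPrefix ρ n) := fun ρ n => by
    induction n with
    | zero => simp [RewardMachine.run, R, st]
    | succ n ih =>
      rw [wordPrefix_succ', ← prefixResidual_comp hd, ← ih]
      exact hnext _ _
  refine ⟨R, rfl, fun ρ n => ?_, ?_, fun q a => by simpa using hbd q [a]⟩
  · induction n with
    | zero => simp [hnil]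
    | succ n ih =>
      rw [Finset.sum_range_succ, ih, wordPrefix_succ', apply_append hd f, length_wordPrefix, ← hrun]
  · classical
    refine ⟨L, block, fun l => if ∃ q a, block q = l ∧ block (next q [a]) = l ∧
      st q [a] = 1 - (d : ℝ) then 1 - (d : ℝ) else 0, hsurj, fun l => ?_, fun q a => ⟨?_, ?_⟩⟩
    · by_cases h : ∃ q a, block q = l ∧ block (next q [a]) = l ∧ st q [a] = 1 - (d : ℝ)
      · exact Or.inr (if_pos h)
      · exact Or.inl (if_neg h)
    · exact hmono _ _ ⟨[a], rfl⟩
    · intro hqa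
      change st q [a] = _
      dsimp only
      by_cases h : ∃ q' a', block q' = block q ∧ block (next q' [a']) = block q ∧
          st q' [a'] = 1 - (d : ℝ)
      · rw [if_pos h]
        obtain ⟨q', a', h₂, h₃, h₄⟩ := h
        rcases huniform q a q' a' hqa h₂ h₃ with h₅ | h₅
        · exact h₅.1.trans (h₅.2.symm.trans h₄)
        · exact h₅.1
      · rw [if_neg h]
        rcases huniform q a q a hqa rfl hqa with h₅ | h₅
        · exact h₅.1
        · exact absurd ⟨q, a, rfl, hqa, h₅.1⟩ h

/-- For discount factor `0`, the value of a formula is determined by the first letter of the word,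
and a machine with an initial and a final state computes it. -/
theorem DLTL.exists_rewardMachine_zero {P : Type*} {d : Set.Ico (0 : ℝ) 1} (hd : (d : ℝ) = 0)
    {φ : DLTL P} (hφ : φ.IsUniform d) :
    ∃ R : RewardMachine (Set P), R.discount = d ∧ (∀ ρ : ℕ → Set P, R.value ρ = φ.sem ρ) ∧
      R.HasTypedPartition ∧ ∀ q σ, 0 ≤ R.r q σ ∧ R.r q σ ≤ 1 - (d : ℝ) := by
  have hsem : ∀ ρ : ℕ → Set P, finVal d φ [ρ 0] = φ.sem ρ := fun ρ => by
    have h := finVal_le_sem hφ ρ 1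
    rw [wordPrefix_succ, wordPrefix_zero] at h
    exact le_antisymm h.1 (h.2.trans_eq (by rw [hd]; simp))
  let R : RewardMachine (Set P) :=
    { Q := Fin 2
      finite_Q := inferInstance
      δ := fun _ _ => 1
      r := fun q σ => if q = 0 then finVal d φ [σ] else 0
      q₀ := 0
      discount := d }
  refine ⟨R, rfl, fun ρ => ?_, ⟨2, id, fun _ => 0, Function.surjective_id, fun _ => Or.inl rfl,
    fun q σ => ⟨Fin.le_last q, fun h => ?_⟩⟩, fun q σ => ?_⟩
  · rw [RewardMachine.value, tsum_eq_single 0]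
    · simp [RewardMachine.run, R, hsem]
    · intro t ht
      simp [R, hd, ht]
  · obtain rfl : (1 : Fin 2) = q := h
    simp [R]
  · rw [hd, sub_zero]
    by_cases hq : q = 0
    · have h := sem_mem_Icc φ fun _ => σ
      rw [← hsem] at h
      simpa [R, hq] using h
    · simp [R, hq]

theorem theorem3 {P : Type*} [Finite P] (d : Set.Ico (0 : ℝ) 1) (φ : DLTL P)
    (hφ : φ.IsUniform d) :
    ∃ R : RewardMachine (Set P),
      R.discount = d ∧
      (∀ ρ : ℕ → Set P, R.value ρ = φ.sem ρ) ∧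
      R.HasTypedPartition ∧
      (∀ (q : R.Q) (σ : Set P), 0 ≤ R.r q σ ∧ R.r q σ ≤ 1 - (d : ℝ)) := by
  have h₁ := d.2.2
  rcases d.2.1.eq_or_lt with h₀ | h₀
  · exact DLTL.exists_rewardMachine_zero h₀.symm hφ
  obtain ⟨S, i, hi⟩ := DLTL.exists_weakSystem (d : ℝ) φ
  obtain ⟨R, hRd, hsum, hpart, hr⟩ := exists_rewardMachine d h₀ (S.fn i) (S.fn_nil i)
    (S.prefixResidual_fn_bounds h₀ h₁.le i) (S.finite_range_prefixResidual h₀ h₁ i)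
    fun w x => S.prefixResidual_cycle h₀ h₁ i
  refine ⟨R, hRd, fun ρ => ?_, hpart, hr⟩
  -- the partial sums are the values of the prefixes, which converge to the value of the word
  have hpow := tendsto_pow_atTop_nhds_zero_of_lt_one d.2.1 h₁
  have hbelow : Filter.Tendsto (fun n => φ.sem ρ - (d : ℝ) ^ n) Filter.atTop (nhds (φ.sem ρ)) := by
    simpa using hpow.const_sub (φ.sem ρ)
  have hlim : Filter.Tendsto (fun n => DLTL.finVal d φ (wordPrefix ρ n)) Filter.atTop
      (nhds (φ.sem ρ)) :=
    tendsto_of_tendsto_of_tendsto_of_le_of_le hbelow tendsto_const_nhds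
      (fun n => by linarith [(DLTL.finVal_le_sem hφ ρ n).2])
      (fun n => (DLTL.finVal_le_sem hφ ρ n).1)
  have hnonneg : ∀ t, 0 ≤ (d : ℝ) ^ t * R.r (R.run ρ t) (ρ t) := fun t =>
    mul_nonneg (pow_nonneg h₀.le t) (hr _ _).1
  rw [RewardMachine.value, hRd]
  refine ((hasSum_iff_tendsto_nat_of_nonneg hnonneg _).2 ?_).tsum_eq
  simpa only [hsum, hi] using hlim
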